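/- Let $n\ge 1$ and let $\Omega\subset\mathbb{C}^n$ be a domain (a non-empty connected open set). Identify $\mathbb{C}^n$ with $\mathbb{R}^{2n}$, with real coordinates $x_1,\dots,x_{2n}$ (the real and imaginary parts of the complex coordinates). Let $E\subset\Omega$ be closed in $\Omega$ with $\mathcal{H}^{2n-1}(E)=0$, where $\mathcal{H}^{2n-1}$ is the $(2n-1)$-dimensional Hausdorff measure. Let $f:\Omega\setminus E\to\mathbb{C}$ be holomorphic and such that (i) $f\in L^1_{\mathrm{loc}}(\Omega)$, (ii) for each $j$, $1\le j\le 2n$, $\dfrac{\partial^2 f}{\partial x_j^2}\in L^1_{\mathrm{loc}}(\Omega)$. Here $f$ and the pointwise derivatives $\partial^2 f/\partial x_j^2$ are functions on $\Omega\setminus E$, and such a function $g$ is in $L^1_{\mathrm{loc}}(\Omega)$ if every point of $\Omega$ (including the points of $E$) has a neighbourhood $U\subset\Omega$ such that $g$ is Lebesgue integrable over $U\setminus E$. Then $f$ has a unique holomorphic extension to $\Omega$, that is, there is exactly one holomorphic function $g:\Omega\to\mathbb{C}$ with $g=f$ on $\Omega\setminus E$. -/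

import Mathlib

open MeasureTheory Set

/-- The `2n` real coordinate directions of `ℂⁿ ≅ ℝ²ⁿ`: with `z_k = x_k + i y_k`, `Sum.inl k` is the
direction of `x_k` and `Sum.inr k` is the direction of `y_k`. -/
noncomputable def realDirection (n : ℕ) : Fin n ⊕ Fin n → EuclideanSpace ℂ (Fin n)
  | Sum.inl k => EuclideanSpace.single k 1
  | Sum.inr k => EuclideanSpace.single k Complex.I

/-- The pure second partial derivative `∂²f/∂x_j²` with respect to the `j`-th real coordinate
of `ℂⁿ ≅ ℝ²ⁿ`. -/
noncomputable def purePartial2 {n : ℕ} (j : Fin n ⊕ Fin n) (f : EuclideanSpace ℂ (Fin n) → ℂ) :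
    EuclideanSpace ℂ (Fin n) → ℂ :=
  fun z => lineDeriv ℝ (fun w => lineDeriv ℝ f w (realDirection n j)) z (realDirection n j)

/-- A function `g` that is given on `Ω \ E` is in `L¹_loc(Ω)`: every point of `Ω` (also the points
of `E`) has a neighbourhood in `Ω` on which `g` is Lebesgue integrable. The values that the total
function `g` takes on `E` play no role, as the measure is restricted to the complement of `E`. -/
def MemL1Loc {n : ℕ} (Ω E : Set (EuclideanSpace ℂ (Fin n)))
    (g : EuclideanSpace ℂ (Fin n) → ℂ) : Prop :=
  LocallyIntegrableOn g Ω (volume.restrict Eᶜ)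

/-- `g` is a holomorphic function on `Ω` that agrees with `f` on `Ω \ E`. -/
def IsHolomorphicExtension {n : ℕ} (Ω E : Set (EuclideanSpace ℂ (Fin n)))
    (f g : EuclideanSpace ℂ (Fin n) → ℂ) : Prop :=
  DifferentiableOn ℂ g Ω ∧ EqOn g f (Ω \ E)

/-! Since `E` has vanishing (2n-1)-dimensional measure, its projection along a coordinate direction
is Lebesgue null, so almost every line in that direction misses `E`. On such a line `f` is smooth
wherever it meets `Ω`, and two integrations by parts against a compactly supported test function
leave no boundary terms. By Fubini, which is where the integrability of `f` and its pure second
derivatives enters, the pointwise second derivatives are weak ones. They sum to zero off `E`, so `f`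
is weakly harmonic on `Ω` (`integral_quadBump_laplacian_smul_eq_zero`).

Explicit test functions then replace Weyl's lemma. Put q = (r² - |y - a|²)₊ and I(r) = ∫ q² f. The
Laplacian of q³ is 6(4r² q - (2n+4) q²), while ∂(q²)/∂r = 4r q; hence weak harmonicity says r I'(r)
= (2n+4) I(r), and I is a multiple of r^(2n+4). Letting r tend to 0 at a point of continuity yields
a weighted mean value property (`integral_quadBump_sq_smul_eq`).

The weighted mean of `f` is a C¹ function of the centre, even across `E`, and equals `f` off `E`.
Complex linearity of its differential is a closed condition that holds on a dense set, so the mean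
is holomorphic. Density of the complement of `E` also glues the local extensions and gives
uniqueness. -/

open Filter Topology

/-! ### Fubini along lines and null sets of codimension one -/

/-- A nonzero direction in a real space of dimension `m + 1` can be split off linearly. -/
theorem exists_continuousLinearEquiv_prod_real {G : Type*} [NormedAddCommGroup G]
    [NormedSpace ℝ G] [FiniteDimensional ℝ G] {m : ℕ} (hm : Module.finrank ℝ G = m + 1)
    {v : G} (hv : v ≠ 0) :
    ∃ L : G ≃L[ℝ] ((Fin m → ℝ) × ℝ), L v = (0, 1) := by
  have h : Module.finrank ℝ ((Fin m → ℝ) × ℝ) = Module.finrank ℝ G := by simp [hm]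
  have L₀ : G ≃L[ℝ] ((Fin m → ℝ) × ℝ) := (ContinuousLinearEquiv.ofFinrankEq h).symm
  obtain ⟨M, hM⟩ : ∃ M : ((Fin m → ℝ) × ℝ) ≃L[ℝ] ((Fin m → ℝ) × ℝ), M (L₀ v) = (0, 1) := by
    apply SeparatingDual.exists_continuousLinearEquiv_apply_eq
    · simpa using hv
    · simp
  exact ⟨L₀.trans M, by simp [hM]⟩

theorem symm_add_smul_of_apply_eq {G : Type*} [NormedAddCommGroup G] [NormedSpace ℝ G] {m : ℕ}
    {v : G} {L : G ≃L[ℝ] ((Fin m → ℝ) × ℝ)} (hL : L v = (0, 1)) (y : Fin m → ℝ) (t : ℝ) :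
    L.symm (y, t) = L.symm (y, 0) + t • v := by
  apply L.injective
  simp [hL]

/-- The lines in a fixed direction that meet an `m`-dimensional null set form a null set. -/
theorem ae_forall_symm_notMem {G : Type*} [NormedAddCommGroup G] [NormedSpace ℝ G]
    [MeasurableSpace G] [BorelSpace G] {m : ℕ}
    (L : G ≃L[ℝ] ((Fin m → ℝ) × ℝ)) {E : Set G} (hE : Measure.hausdorffMeasure (m : ℝ) E = 0) :
    ∀ᵐ y : Fin m → ℝ, ∀ t : ℝ, L.symm (y, t) ∉ E := by
  let T : G →L[ℝ] (Fin m → ℝ) := (ContinuousLinearMap.fst ℝ _ ℝ).comp (L : G →L[ℝ] _)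
  have h0 : volume (T '' E) = 0 := by
    have h1 := T.lipschitz.hausdorffMeasure_image_le (d := (m : ℝ)) (by positivity) E
    rw [hE, mul_zero] at h1
    -- For the sup norm on `Fin m → ℝ` the m-dimensional Hausdorff measure is exactly Lebesgue
    -- measure, so the Lipschitz image of `E` is Lebesgue null.
    have h2 : (Measure.hausdorffMeasure (m : ℝ) : Measure (Fin m → ℝ)) = volume := by
      simpa using (hausdorffMeasure_pi_real (ι := Fin m))
    rw [h2] at h1
    exact le_antisymm h1 bot_le
  filter_upwards [measure_eq_zero_iff_ae_notMem.1 h0] with y hy t ht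
  exact hy ⟨_, ht, by simp [T]⟩

section Lines

variable {G : Type*} [NormedAddCommGroup G] [NormedSpace ℝ G]
  [MeasurableSpace G] [BorelSpace G] (μ : Measure G) [μ.IsAddHaarMeasure] {m : ℕ} {v : G}

/-- Uniqueness of Haar measure. The value of the factor is irrelevant, since only the vanishing of
measures and integrals is transported. -/
theorem exists_map_eq_smul_volume (L : G ≃L[ℝ] ((Fin m → ℝ) × ℝ)) :
    ∃ c : NNReal, μ.map L = c • (volume : Measure (Fin m → ℝ)).prod (volume : Measure ℝ) :=
  ⟨_, Measure.isAddLeftInvariant_eq_smul _ _⟩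

variable [FiniteDimensional ℝ G]

/-- A set of vanishing Hausdorff measure of codimension one is a Lebesgue null set. -/
theorem measure_eq_zero_of_hausdorffMeasure (hm : Module.finrank ℝ G = m + 1) {E : Set G}
    (hE : Measure.hausdorffMeasure (m : ℝ) E = 0) : μ E = 0 := by
  have : Nontrivial G := Module.nontrivial_of_finrank_pos (R := ℝ) (by omega)
  obtain ⟨v, hv⟩ := exists_ne (0 : G)
  obtain ⟨L, -⟩ := exists_continuousLinearEquiv_prod_real hm hv
  obtain ⟨c, hc⟩ := exists_map_eq_smul_volume μ L
  have L_emb : MeasurableEmbedding L := L.toHomeomorph.measurableEmbedding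
  have h1 : μ E = (μ.map L) (L '' E) := by
    rw [L_emb.map_apply, preimage_image_eq _ L.injective]
  have h2 : (volume : Measure (Fin m → ℝ)).prod (volume : Measure ℝ) (L '' E) = 0 := by
    have h3 : volume {y : Fin m → ℝ | ¬ ∀ t : ℝ, L.symm (y, t) ∉ E} = 0 :=
      ae_forall_symm_notMem L hE
    refine measure_mono_null (t := {y : Fin m → ℝ | ¬ ∀ t : ℝ, L.symm (y, t) ∉ E} ×ˢ univ) ?_ ?_
    · rintro _ ⟨x, hx, rfl⟩
      simp only [mem_prod, mem_ofPred_eq, mem_univ, and_true, not_forall, not_not]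
      exact ⟨(L x).2, by simpa using hx⟩
    · rw [Measure.prod_prod, h3, zero_mul]
  rw [h1, hc]
  simp [h2]

/-- If an integrable function has vanishing integral over all the lines in a fixed direction that
avoid a set of vanishing Hausdorff measure of codimension one, then its integral vanishes. -/
theorem integral_eq_zero_of_forall_line (hm : Module.finrank ℝ G = m + 1) {E : Set G}
    (hE : Measure.hausdorffMeasure (m : ℝ) E = 0) (hv : v ≠ 0) {F : G → ℂ} (hF : Integrable F μ)
    (h : ∀ x, (∀ t : ℝ, x + t • v ∉ E) → Integrable (fun t : ℝ => F (x + t • v)) →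
      ∫ t : ℝ, F (x + t • v) = 0) :
    ∫ x, F x ∂μ = 0 := by
  obtain ⟨L, hL⟩ := exists_continuousLinearEquiv_prod_real hm hv
  obtain ⟨c, hc⟩ := exists_map_eq_smul_volume μ L
  have L_emb : MeasurableEmbedding L := L.toHomeomorph.measurableEmbedding
  have hc0 : c ≠ 0 := by
    rintro rfl
    have h0 : μ.map L = 0 := by simpa using hc
    rw [Measure.map_eq_zero_iff L_emb.measurable.aemeasurable] at h0
    exact NeZero.ne μ h0
  have h1 : ∫ x, F x ∂μ = ∫ p, F (L.symm p) ∂(μ.map L) := by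
    rw [L_emb.integral_map]; simp
  have h2 : Integrable (fun p => F (L.symm p)) (μ.map L) := by
    rw [L_emb.integrable_map_iff]; simpa [Function.comp_def] using hF
  have h3 : Integrable (fun p => F (L.symm p))
      ((volume : Measure (Fin m → ℝ)).prod (volume : Measure ℝ)) := by
    rw [hc] at h2
    exact (integrable_smul_measure (c := (c : ENNReal)) (by simpa using hc0) (by simp)).1 h2
  rw [h1, hc, integral_smul_nnreal_measure, integral_prod _ h3,
    integral_eq_zero_of_ae, smul_zero]
  filter_upwards [ae_forall_symm_notMem L hE, h3.prod_right_ae] with y hy hint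
  have hs : ∀ t, L.symm (y, t) = L.symm (y, 0) + t • v := symm_add_smul_of_apply_eq hL y
  generalize L.symm (y, 0) = x at hs
  simp only [hs] at hy hint ⊢
  exact h _ hy hint

end Lines

/-! ### Holomorphic functions along real lines -/

theorem HasLineDerivAt.hasDerivAt_line {G F : Type*} [NormedAddCommGroup G] [NormedSpace ℝ G]
    [NormedAddCommGroup F] [NormedSpace ℝ F] {f : G → F} {f' : F} {x v : G} {t : ℝ}
    (h : HasLineDerivAt ℝ f f' (x + t • v) v) : HasDerivAt (fun s : ℝ => f (x + s • v)) f' t := by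
  have h1 : HasDerivAt (fun s : ℝ => f (x + t • v + s • v)) f' (t - t) := by
    rw [sub_self]; exact h
  convert! h1.comp_sub_const t t using 3 with s
  rw [add_assoc, ← add_smul]
  congr 2
  ring

section Holomorphic

variable {G : Type*} [NormedAddCommGroup G] [NormedSpace ℂ G] {U : Set G} {f : G → ℂ} {w : G}

theorem differentiableOn_comp_line (hf : DifferentiableOn ℂ f U) (w v : G) :
    DifferentiableOn ℂ (fun z : ℂ => f (w + z • v)) ((fun z : ℂ => w + z • v) ⁻¹' U) :=
  hf.comp (by fun_prop) fun _ hz => hz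

variable [NormedSpace ℝ G] [IsScalarTower ℝ ℂ G]

theorem hasLineDerivAt_of_differentiableOn (hU : IsOpen U) (hf : DifferentiableOn ℂ f U)
    (hw : w ∈ U) (v : G) :
    HasLineDerivAt ℝ f (deriv (fun z : ℂ => f (w + z • v)) 0) w v := by
  have hV : IsOpen ((fun z : ℂ => w + z • v) ⁻¹' U) := hU.preimage (by fun_prop)
  have h1 : HasDerivAt (fun z : ℂ => f (w + z • v)) (deriv (fun z : ℂ => f (w + z • v)) 0)
      ((0 : ℝ) : ℂ) := by
    rw [Complex.ofReal_zero]
    exact ((differentiableOn_comp_line hf w v).differentiableAt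
      (hV.mem_nhds (by simpa using hw))).hasDerivAt
  have hs (t : ℝ) : (t : ℂ) • v = t • v := algebraMap_smul ℂ t v
  simpa only [HasLineDerivAt, hs] using h1.comp_ofReal

/-- The slice in the complex line spanned by `v` is holomorphic in one variable, so its derivative
is holomorphic again; no regularity theory in several variables is needed. -/
theorem hasLineDerivAt_lineDeriv_of_differentiableOn (hU : IsOpen U)
    (hf : DifferentiableOn ℂ f U) (hw : w ∈ U) (v : G) :
    HasLineDerivAt ℝ (fun y => lineDeriv ℝ f y v)
      (deriv (deriv (fun z : ℂ => f (w + z • v))) 0) w v := by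
  have hV : IsOpen ((fun z : ℂ => w + z • v) ⁻¹' U) := hU.preimage (by fun_prop)
  have h1 : HasDerivAt (deriv (fun z : ℂ => f (w + z • v)))
      (deriv (deriv (fun z : ℂ => f (w + z • v))) 0) ((0 : ℝ) : ℂ) := by
    rw [Complex.ofReal_zero]
    exact (((differentiableOn_comp_line hf w v).deriv hV).differentiableAt
      (hV.mem_nhds (by simpa using hw))).hasDerivAt
  refine h1.comp_ofReal.congr_of_eventuallyEq ?_
  have h2 : ∀ᶠ t : ℝ in 𝓝 0, w + t • v ∈ U := by
    have h3 : IsOpen ((fun t : ℝ => w + t • v) ⁻¹' U) := hU.preimage (by fun_prop)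
    exact h3.mem_nhds (by simpa using hw)
  filter_upwards [h2] with t ht
  rw [(hasLineDerivAt_of_differentiableOn hU hf ht v).lineDeriv]
  have h4 : (fun z : ℂ => f (w + t • v + z • v)) = fun z : ℂ => f (w + ((t : ℂ) + z) • v) := by
    ext z
    rw [add_smul, add_assoc, show (t : ℂ) • v = t • v from algebraMap_smul ℂ t v]
  rw [h4, deriv_comp_const_add (fun z : ℂ => f (w + z • v))]
  simp

/-- The second derivatives of a holomorphic function in the directions `v` and `i v` cancel. -/
theorem lineDeriv_lineDeriv_add_I_smul (hU : IsOpen U) (hf : DifferentiableOn ℂ f U)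
    (hw : w ∈ U) (v : G) :
    lineDeriv ℝ (fun y => lineDeriv ℝ f y v) w v +
      lineDeriv ℝ (fun y => lineDeriv ℝ f y (Complex.I • v)) w (Complex.I • v) = 0 := by
  rw [(hasLineDerivAt_lineDeriv_of_differentiableOn hU hf hw v).lineDeriv,
    (hasLineDerivAt_lineDeriv_of_differentiableOn hU hf hw (Complex.I • v)).lineDeriv]
  have h1 : (fun z : ℂ => f (w + z • Complex.I • v)) =
      fun z => (fun y : ℂ => f (w + y • v)) (Complex.I * z) := by
    ext z
    simp only [smul_smul, mul_comm]
  have h2 : deriv (fun z : ℂ => f (w + z • Complex.I • v)) =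
      fun z => Complex.I • deriv (fun y : ℂ => f (w + y • v)) (Complex.I * z) := by
    ext z
    rw [h1, deriv_comp_mul_left Complex.I (fun y : ℂ => f (w + y • v))]
  rw [h2, deriv_fun_const_smul_field,
    deriv_comp_mul_left Complex.I (deriv fun y : ℂ => f (w + y • v)), smul_smul, Complex.I_mul_I]
  simp

/-- Two integrations by parts along a line, on which `f` is holomorphic wherever it meets `Ω`. -/
theorem integral_line_smul_sub_eq_zero {Ω E K : Set G} (hU : IsOpen (Ω \ E))
    (hf : DifferentiableOn ℂ f (Ω \ E)) (hK : IsCompact K) (hKΩ : K ⊆ Ω) {v : G} (hv : v ≠ 0)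
    {φ φ₁ φ₂ : G → ℝ} (h₁ : ∀ y, HasLineDerivAt ℝ φ (φ₁ y) y v)
    (h₂ : ∀ y, HasLineDerivAt ℝ φ₁ (φ₂ y) y v)
    (hφ : ∀ y ∉ K, φ y = 0) (hφ₁ : ∀ y ∉ K, φ₁ y = 0) (hφ₂ : ∀ y ∉ K, φ₂ y = 0)
    {x : G} (hx : ∀ t : ℝ, x + t • v ∉ E)
    (hint : Integrable fun t : ℝ => φ₂ (x + t • v) • f (x + t • v) -
      φ (x + t • v) • lineDeriv ℝ (fun y => lineDeriv ℝ f y v) (x + t • v) v) :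
    ∫ t : ℝ, (φ₂ (x + t • v) • f (x + t • v) -
      φ (x + t • v) • lineDeriv ℝ (fun y => lineDeriv ℝ f y v) (x + t • v) v) = 0 := by
  -- An antiderivative of the integrand: in φ₁ f - φ f' the mixed terms φ₁ f' cancel upon
  -- differentiation.
  set W : ℝ → ℂ := fun t => φ₁ (x + t • v) • f (x + t • v) -
    φ (x + t • v) • lineDeriv ℝ f (x + t • v) v with hW
  have hcoc : Tendsto (fun t : ℝ => x + t • v) (cocompact ℝ) (cocompact G) :=
    ((Homeomorph.addLeft x).isClosedEmbedding.comp
      (isClosedEmbedding_smul_left hv)).tendsto_cocompact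
  have hW0 : ∀ t, x + t • v ∉ K → W t = 0 := fun t ht => by simp [hW, hφ _ ht, hφ₁ _ ht]
  have hev : ∀ᶠ t in cocompact ℝ, W t = 0 := by
    filter_upwards [hcoc hK.compl_mem_cocompact] with t ht using hW0 t ht
  have hlim : Tendsto W (cocompact ℝ) (𝓝 0) :=
    tendsto_const_nhds.congr' (hev.mono fun t ht => ht.symm)
  have key := integral_of_hasDerivAt_of_tendsto (f := W) (m := 0) (n := 0) ?_ hint
    (hlim.mono_left atBot_le_cocompact) (hlim.mono_left atTop_le_cocompact)
  · simpa using key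
  intro t
  by_cases ht : x + t • v ∈ Ω
  · have hw : x + t • v ∈ Ω \ E := ⟨ht, hx t⟩
    have d1 := (hasLineDerivAt_of_differentiableOn hU hf hw v)
    have d2 := (hasLineDerivAt_lineDeriv_of_differentiableOn hU hf hw v)
    have e1 := (d1.lineDeriv ▸ d1).hasDerivAt_line
    have e2 := (d2.lineDeriv ▸ d2).hasDerivAt_line
    have p1 := (h₁ (x + t • v)).hasDerivAt_line
    have p2 := (h₂ (x + t • v)).hasDerivAt_line
    convert! (p2.smul e1).sub (p1.smul e2) using 1
    abel
  -- Outside `Ω` nothing is known about `f`, but there `W` vanishes in a whole neighbourhood,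
  -- because the complement of `K` is open.
  · have hk : x + t • v ∉ K := fun h => ht (hKΩ h)
    have hz : ∀ᶠ s in 𝓝 t, W s = 0 := by
      have : IsOpen ((fun s : ℝ => x + s • v) ⁻¹' Kᶜ) :=
        hK.isClosed.isOpen_compl.preimage (by fun_prop)
      filter_upwards [this.mem_nhds hk] with s hs using hW0 s hs
    rw [hφ _ hk, hφ₂ _ hk]
    simpa using (hasDerivAt_const t (0 : ℂ)).congr_of_eventuallyEq hz

end Holomorphic

/-! ### The test function and its derivatives -/

/-- Powers `(max 0 u) ^ (k + 2)` of the positive part are differentiable. -/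
theorem hasDerivAt_max_zero_pow (k : ℕ) (u : ℝ) :
    HasDerivAt (fun u : ℝ => max 0 u ^ (k + 2)) ((k + 2) * max 0 u ^ (k + 1)) u := by
  rcases lt_trichotomy u 0 with hu | rfl | hu
  · rw [max_eq_left hu.le, zero_pow (by omega), mul_zero]
    refine (hasDerivAt_const u (0 : ℝ)).congr_of_eventuallyEq ?_
    filter_upwards [Iio_mem_nhds hu] with y hy
    rw [max_eq_left (le_of_lt hy), zero_pow (by omega)]
  · rw [max_self, zero_pow (by omega), mul_zero, hasDerivAt_iff_isLittleO]
    simp only [max_self, sub_zero, smul_zero, zero_pow (show k + 2 ≠ 0 by omega)]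
    have h1 : (fun u : ℝ => max 0 u ^ (k + 2)) =O[𝓝 0] fun u : ℝ => u ^ (k + 2) := by
      refine Asymptotics.IsBigO.of_bound 1 (Eventually.of_forall fun y => ?_)
      rw [one_mul, norm_pow, norm_pow]
      refine pow_le_pow_left₀ (norm_nonneg _) ?_ _
      rw [Real.norm_eq_abs, Real.norm_eq_abs, abs_of_nonneg (le_max_left _ _)]
      exact max_le (abs_nonneg _) (le_abs_self _)
    refine h1.trans_isLittleO ?_
    simpa using Asymptotics.isLittleO_pow_pow (𝕜 := ℝ) (show 1 < k + 2 by omega)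
  · rw [max_eq_right hu.le]
    have h1 := hasDerivAt_pow (k + 2) u
    rw [show ((k + 2 : ℕ) : ℝ) = (k : ℝ) + 2 by push_cast; ring,
      show k + 2 - 1 = k + 1 by omega] at h1
    refine h1.congr_of_eventuallyEq ?_
    filter_upwards [Ioi_mem_nhds hu] with y hy
    rw [max_eq_right (le_of_lt hy)]

/-- A continuous function supported in a compact subset of `Ω` times a locally integrable function
is integrable. -/
theorem integrable_smul_of_locallyIntegrableOn {G : Type*} [NormedAddCommGroup G]
    [MeasurableSpace G] [BorelSpace G] {μ : Measure G} {Ω K : Set G} {g : G → ℂ}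
    (hg : LocallyIntegrableOn g Ω μ) (hK : IsCompact K) (hKΩ : K ⊆ Ω) {ψ : G → ℝ}
    (hψ : Continuous ψ) (hψK : ∀ y ∉ K, ψ y = 0) : Integrable (fun y => ψ y • g y) μ := by
  have h1 : IntegrableOn g K μ := hg.integrableOn_compact_subset hKΩ hK
  have h2 : IntegrableOn (fun y => ψ y • g y) K μ := h1.continuousOn_smul hψ.continuousOn hK
  refine (integrableOn_iff_integrable_of_support_subset fun y hy => ?_).1 h2
  by_contra h
  exact hy (by simp [hψK y h])

/-- The function `y ↦ (r² - |y - a|²)₊`. -/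
noncomputable def quadBump {G : Type*} [NormedAddCommGroup G] (a : G) (r : ℝ) (y : G) : ℝ :=
  max 0 (r ^ 2 - ‖y - a‖ ^ 2)

section QuadBump

variable {G : Type*} [NormedAddCommGroup G] {a y : G} {r : ℝ}

theorem quadBump_nonneg : 0 ≤ quadBump a r y := le_max_left _ _

theorem quadBump_le : quadBump a r y ≤ r ^ 2 :=
  max_le (sq_nonneg r) (sub_le_self _ (sq_nonneg _))

theorem quadBump_eq_zero (hr : 0 ≤ r) (hy : y ∉ Metric.closedBall a r) :
    quadBump a r y = 0 := by
  rw [Metric.mem_closedBall, dist_eq_norm, not_le] at hy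
  exact max_eq_left (by nlinarith)

theorem continuous_quadBump : Continuous (quadBump a r) := by
  unfold quadBump; fun_prop

/-- Makes the Laplacian of the cubed bump a polynomial in the bump alone, also where the bump
vanishes. -/
theorem norm_sq_mul_quadBump :
    ‖y - a‖ ^ 2 * quadBump a r y = r ^ 2 * quadBump a r y - quadBump a r y ^ 2 := by
  rcases le_total (r ^ 2 - ‖y - a‖ ^ 2) 0 with h | h
  · simp [quadBump, max_eq_left h]
  · simp only [quadBump, max_eq_right h]; ring

variable [InnerProductSpace ℝ G]

theorem hasLineDerivAt_quadBump_pow (k : ℕ) (a y v : G) (r : ℝ) :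
    HasLineDerivAt ℝ (fun y => quadBump a r y ^ (k + 2))
      (-2 * (k + 2) * inner ℝ (y - a) v * quadBump a r y ^ (k + 1)) y v := by
  have h0 : HasDerivAt (fun t : ℝ => y - a + t • v) v 0 := by
    simpa using ((hasDerivAt_id (0 : ℝ)).smul_const v).const_add (y - a)
  have h1 := (h0.norm_sq.const_sub (r ^ 2))
  have h2 := (hasDerivAt_max_zero_pow k (r ^ 2 - ‖y - a + (0 : ℝ) • v‖ ^ 2)).comp 0 h1
  have h3 : (fun t : ℝ => quadBump a r (y + t • v) ^ (k + 2)) =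
      (fun u : ℝ => max 0 u ^ (k + 2)) ∘ fun t : ℝ => r ^ 2 - ‖y - a + t • v‖ ^ 2 := by
    ext t
    simp only [quadBump, Function.comp_apply]
    rw [add_sub_right_comm]
  rw [HasLineDerivAt, h3]
  convert! h2 using 1
  simp only [zero_smul, add_zero, quadBump]
  ring

theorem hasLineDerivAt_inner_mul_quadBump_sq (a y v : G) (r : ℝ) (hv : ‖v‖ = 1) :
    HasLineDerivAt ℝ (fun y => -6 * inner ℝ (y - a) v * quadBump a r y ^ 2)
      (24 * inner ℝ (y - a) v ^ 2 * quadBump a r y - 6 * quadBump a r y ^ 2) y v := by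
  have h0 : HasDerivAt (fun t : ℝ => y + t • v - a) v 0 := by
    simpa using (((hasDerivAt_id (0 : ℝ)).smul_const v).const_add y).sub_const a
  have h1 := (h0.inner ℝ (hasDerivAt_const (0 : ℝ) v)).const_mul (-6)
  have h2 : HasDerivAt (fun t : ℝ => quadBump a r (y + t • v) ^ 2) _ 0 :=
    hasLineDerivAt_quadBump_pow 0 a y v r
  rw [HasLineDerivAt]
  convert! h1.mul h2 using 1
  simp only [zero_smul, add_zero, inner_zero_right, real_inner_self_eq_norm_sq, hv]
  push_cast
  ring

end QuadBump

/-! ### Weak harmonicity -/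

section Euclidean

variable {n : ℕ}

theorem norm_realDirection (j : Fin n ⊕ Fin n) : ‖realDirection n j‖ = 1 := by
  cases j <;> simp [realDirection]

/-- Parseval: the coordinate directions form a real orthonormal basis. -/
theorem sum_inner_realDirection_sq (x : EuclideanSpace ℂ (Fin n)) :
    ∑ j, inner ℝ x (realDirection n j) ^ 2 = ‖x‖ ^ 2 := by
  rw [EuclideanSpace.norm_sq_eq, Fintype.sum_sum_type, ← Finset.sum_add_distrib]
  refine Finset.sum_congr rfl fun k _ => ?_
  have h (c : ℂ) : inner ℝ x (EuclideanSpace.single k c) = inner ℝ (x k) c := by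
    rw [PiLp.inner_apply, Finset.sum_eq_single k] <;> simp +contextual
  simp only [realDirection, h, Complex.inner, Complex.sq_norm, Complex.normSq_apply]
  simp
  ring

theorem sum_purePartial2_eq_zero {U : Set (EuclideanSpace ℂ (Fin n))} (hU : IsOpen U)
    {f : EuclideanSpace ℂ (Fin n) → ℂ} (hf : DifferentiableOn ℂ f U)
    {w : EuclideanSpace ℂ (Fin n)} (hw : w ∈ U) : ∑ j, purePartial2 j f w = 0 := by
  rw [Fintype.sum_sum_type, ← Finset.sum_add_distrib]
  refine Finset.sum_eq_zero fun k _ => ?_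
  have h : EuclideanSpace.single k Complex.I = Complex.I • EuclideanSpace.single k (1 : ℂ) := by
    ext i
    simp
  simp only [purePartial2, realDirection, h]
  exact lineDeriv_lineDeriv_add_I_smul hU hf hw _

theorem finrank_real_euclideanSpace_complex (hn : 1 ≤ n) :
    Module.finrank ℝ (EuclideanSpace ℂ (Fin n)) = (2 * n - 1) + 1 := by
  rw [← Module.finrank_mul_finrank ℝ ℂ, Complex.finrank_real_complex, finrank_euclideanSpace_fin]
  omega

/-- A holomorphic function off a set of vanishing Hausdorff measure of codimension one, with
locally integrable pure second derivatives, is weakly harmonic. -/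
theorem integral_quadBump_laplacian_smul_eq_zero (hn : 1 ≤ n)
    {Ω E : Set (EuclideanSpace ℂ (Fin n))} (hU : IsOpen (Ω \ E))
    (hE : Measure.hausdorffMeasure ((2 * n - 1 : ℕ) : ℝ) E = 0)
    {f : EuclideanSpace ℂ (Fin n) → ℂ} (hf : DifferentiableOn ℂ f (Ω \ E))
    (hf_int : LocallyIntegrableOn f Ω)
    (hf_int2 : ∀ j, LocallyIntegrableOn (purePartial2 j f) Ω)
    {a : EuclideanSpace ℂ (Fin n)} {r : ℝ} (hr : 0 ≤ r) (ha : Metric.closedBall a r ⊆ Ω) :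
    ∫ y, (4 * r ^ 2 * quadBump a r y - (2 * n + 4) * quadBump a r y ^ 2) • f y = 0 := by
  have hK : IsCompact (Metric.closedBall a r) := isCompact_closedBall a r
  have hE0 : volume E = 0 :=
    measure_eq_zero_of_hausdorffMeasure volume (finrank_real_euclideanSpace_complex hn) hE
  have hq : Continuous (quadBump a r) := continuous_quadBump
  have hq0 : ∀ y ∉ Metric.closedBall a r, quadBump a r y = 0 := fun y => quadBump_eq_zero hr
  set φ₂ : Fin n ⊕ Fin n → EuclideanSpace ℂ (Fin n) → ℝ := fun j y =>
    24 * inner ℝ (y - a) (realDirection n j) ^ 2 * quadBump a r y - 6 * quadBump a r y ^ 2 with hφ₂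
  have hint (j) : Integrable fun y => φ₂ j y • f y - quadBump a r y ^ 3 • purePartial2 j f y := by
    refine (integrable_smul_of_locallyIntegrableOn hf_int hK ha (by fun_prop) fun y hy => ?_).sub
      (integrable_smul_of_locallyIntegrableOn (hf_int2 j) hK ha (by fun_prop) fun y hy => ?_)
    · simp [hφ₂, hq0 y hy]
    · simp [hq0 y hy]
  have h0 (j) : ∫ y, (φ₂ j y • f y - quadBump a r y ^ 3 • purePartial2 j f y) = 0 := by
    have hv : realDirection n j ≠ 0 := norm_ne_zero_iff.1 (by simp [norm_realDirection])
    refine integral_eq_zero_of_forall_line volume (finrank_real_euclideanSpace_complex hn) hE hv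
      (hint j) fun x hx hx_int => ?_
    refine integral_line_smul_sub_eq_zero hU hf hK ha hv
      -- The cube is the lowest power of the bump that is twice differentiable across the sphere.
      (φ := fun y => quadBump a r y ^ 3)
      (φ₁ := fun y => -6 * inner ℝ (y - a) (realDirection n j) * quadBump a r y ^ 2)
      (φ₂ := φ₂ j) (fun y => ?_)
      (fun y => hasLineDerivAt_inner_mul_quadBump_sq a y _ r (norm_realDirection j))
      (fun y hy => ?_) (fun y hy => ?_) (fun y hy => ?_) hx hx_int
    · convert! hasLineDerivAt_quadBump_pow 1 a y (realDirection n j) r using 1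
      push_cast
      ring
    all_goals simp [hφ₂, hq0 y hy]
  have hsum : ∫ y, ∑ j, (φ₂ j y • f y - quadBump a r y ^ 3 • purePartial2 j f y) = 0 := by
    rw [integral_finsetSum _ fun j _ => hint j]
    exact Finset.sum_eq_zero fun j _ => h0 j
  -- Off `E` the second derivatives of `f` cancel. Those of the cubed bump sum to 24|y - a|² q - 12n
  -- q², with q the bump, and |y - a|² q = r² q - q².
  have hae : ∀ᵐ y, ∑ j, (φ₂ j y • f y - quadBump a r y ^ 3 • purePartial2 j f y) =
      (6 : ℝ) • (4 * r ^ 2 * quadBump a r y - (2 * n + 4) * quadBump a r y ^ 2) • f y := by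
    filter_upwards [measure_eq_zero_iff_ae_notMem.1 hE0] with y hyE
    by_cases hy : y ∈ Metric.closedBall a r
    · rw [Finset.sum_sub_distrib, ← Finset.smul_sum, ← Finset.sum_smul,
        sum_purePartial2_eq_zero hU hf ⟨ha hy, hyE⟩, smul_zero, sub_zero, smul_smul]
      congr 1
      simp only [hφ₂, Finset.sum_sub_distrib, ← Finset.sum_mul, ← Finset.mul_sum,
        sum_inner_realDirection_sq, mul_assoc, norm_sq_mul_quadBump]
      simp
      ring
    · simp [hφ₂, hq0 y hy]
  rw [integral_congr_ae hae, integral_smul] at hsum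
  exact (smul_eq_zero.1 hsum).resolve_left (by norm_num)

end Euclidean

/-! ### The weighted mean value property -/

theorem hasDerivAt_quadBump_sq {G : Type*} [NormedAddCommGroup G] (a y : G) (r : ℝ) :
    HasDerivAt (fun r => quadBump a r y ^ 2) (4 * r * quadBump a r y) r := by
  have h1 := ((hasDerivAt_pow 2 r).sub_const (‖y - a‖ ^ 2))
  have h2 := (hasDerivAt_max_zero_pow 0 (r ^ 2 - ‖y - a‖ ^ 2)).comp r h1
  convert! h2 using 1
  simp only [quadBump]
  push_cast
  ring

theorem integral_quadBump_sq_eq {G : Type*} [NormedAddCommGroup G] [MeasurableSpace G]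
    [BorelSpace G] {μ : Measure G} [μ.IsAddHaarMeasure] (a : G) (r : ℝ) :
    ∫ y, quadBump a r y ^ 2 ∂μ = ∫ y, quadBump 0 r y ^ 2 ∂μ := by
  rw [← integral_sub_right_eq_self (fun y => quadBump 0 r y ^ 2) a]
  simp [quadBump]

section MeanValue

variable {G : Type*} [NormedAddCommGroup G] [NormedSpace ℝ G] [FiniteDimensional ℝ G]
  [MeasurableSpace G] [BorelSpace G] {μ : Measure G} {f : G → ℂ} {a : G} {R : ℝ}

theorem integrable_quadBump_pow_smul {r : ℝ} (hf : IntegrableOn f (Metric.closedBall a r) μ)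
    (hr : 0 ≤ r) {k : ℕ} (hk : k ≠ 0) : Integrable (fun y => quadBump a r y ^ k • f y) μ := by
  have hq : Continuous (quadBump a r) := continuous_quadBump
  have h2 : IntegrableOn (fun y => quadBump a r y ^ k • f y) (Metric.closedBall a r) μ :=
    hf.continuousOn_smul (by fun_prop) (isCompact_closedBall a r)
  refine (integrableOn_iff_integrable_of_support_subset fun y hy => ?_).1 h2
  by_contra h
  exact hy (by simp [quadBump_eq_zero hr h, hk])

/-- Multiplied by `r`, this derivative is the first term of the weak harmonicity identity, which
thereby becomes an Euler equation in `r`. -/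
theorem hasDerivAt_integral_quadBump_sq (hf : IntegrableOn f (Metric.closedBall a R) μ) {r : ℝ}
    (hr : r ∈ Ioo 0 R) :
    HasDerivAt (fun r => ∫ y, quadBump a r y ^ 2 • f y ∂μ)
      (∫ y, (4 * r * quadBump a r y) • f y ∂μ) r := by
  have hsub {s : ℝ} (hs : s ∈ Ioo 0 R) : IntegrableOn f (Metric.closedBall a s) μ :=
    hf.mono_set (Metric.closedBall_subset_closedBall hs.2.le)
  have hR : 0 < R := hr.1.trans hr.2
  have hi {s : ℝ} (hs : s ∈ Ioo 0 R) :
      Integrable (fun y => (4 * s * quadBump a s y) • f y) μ := by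
    have h1 := (integrable_quadBump_pow_smul (hsub hs) hs.1.le one_ne_zero).smul (4 * s)
    simp only [pow_one] at h1
    refine h1.congr (Eventually.of_forall fun y => ?_)
    simp only [Pi.smul_apply, smul_smul]
  refine (hasDerivAt_integral_of_dominated_loc_of_deriv_le (s := Ioo 0 R)
    (F := fun r y => quadBump a r y ^ 2 • f y) (F' := fun r y => (4 * r * quadBump a r y) • f y)
    (bound := (Metric.closedBall a R).indicator fun y => 4 * R * R ^ 2 * ‖f y‖)
    (Ioo_mem_nhds hr.1 hr.2) ?_ ?_ ?_ ?_ ?_ ?_).2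
  · filter_upwards [Ioo_mem_nhds hr.1 hr.2] with s hs
    exact (integrable_quadBump_pow_smul (hsub hs) hs.1.le two_ne_zero).aestronglyMeasurable
  · exact integrable_quadBump_pow_smul (hsub hr) hr.1.le two_ne_zero
  · exact (hi hr).aestronglyMeasurable
  · refine Eventually.of_forall fun y s hs => ?_
    by_cases hy : y ∈ Metric.closedBall a R
    · have hq : 0 ≤ quadBump a s y := quadBump_nonneg
      rw [indicator_of_mem hy, norm_smul, Real.norm_eq_abs,
        abs_of_nonneg (mul_nonneg (by linarith [hs.1]) hq)]
      have : quadBump a s y ≤ R ^ 2 :=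
        quadBump_le.trans (pow_le_pow_left₀ hs.1.le hs.2.le 2)
      have h4 := hs.2.le
      gcongr
    · have hy' : y ∉ Metric.closedBall a s :=
        fun h => hy (Metric.closedBall_subset_closedBall hs.2.le h)
      simp [indicator_of_notMem hy, quadBump_eq_zero hs.1.le hy']
  · exact (integrable_indicator_iff measurableSet_closedBall).2 (hf.norm.const_mul _)
  · exact Eventually.of_forall fun y s _ => (hasDerivAt_quadBump_sq a y s).smul_const (f y)

/-- If `f` is weakly harmonic, then its integrals against `(r² - |y - a|²)₊²` are homogeneous
in `r`. -/
theorem exists_integral_quadBump_sq_eq (hf : IntegrableOn f (Metric.closedBall a R) μ) {m : ℕ}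
    (h : ∀ r ∈ Ioo 0 R,
      ∫ y, (4 * r ^ 2 * quadBump a r y - m * quadBump a r y ^ 2) • f y ∂μ = 0) :
    ∃ c : ℂ, ∀ r ∈ Ioo 0 R, ∫ y, quadBump a r y ^ 2 • f y ∂μ = r ^ m • c := by
  have hderiv : ∀ r ∈ Ioo 0 R,
      HasDerivAt (fun r => (r ^ m)⁻¹ • ∫ y, quadBump a r y ^ 2 • f y ∂μ) 0 r := by
    intro r hr
    have hsub : IntegrableOn f (Metric.closedBall a r) μ :=
      hf.mono_set (Metric.closedBall_subset_closedBall hr.2.le)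
    have hi1 := (integrable_quadBump_pow_smul hsub hr.1.le one_ne_zero)
    have hi2 := (integrable_quadBump_pow_smul hsub hr.1.le two_ne_zero)
    simp only [pow_one] at hi1
    have key := h r hr
    simp only [sub_smul, mul_smul _ (quadBump a r _), mul_smul (m : ℝ)] at key
    have hi3 : Integrable (fun y => (4 * r ^ 2) • quadBump a r y • f y) μ :=
      hi1.smul (4 * r ^ 2)
    have hi4 : Integrable (fun y => (m : ℝ) • quadBump a r y ^ 2 • f y) μ :=
      hi2.smul (m : ℝ)
    rw [integral_sub hi3 hi4, integral_smul, integral_smul, sub_eq_zero] at key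
    have h1 := ((hasDerivAt_pow m r).inv (pow_ne_zero m hr.1.ne')).smul
      (hasDerivAt_integral_quadBump_sq hf hr)
    convert! h1 using 1
    simp only [mul_smul _ (quadBump a r _)]
    rw [integral_smul]
    have hr0 : r ≠ 0 := hr.1.ne'
    have h4 : (4 * r) • ∫ y, quadBump a r y • f y ∂μ =
        (m * r⁻¹) • ∫ y, quadBump a r y ^ 2 • f y ∂μ := by
      have : (4 * r) = r⁻¹ * (4 * r ^ 2) := by field_simp
      rw [this, mul_smul, key, smul_smul, mul_comm]
    rw [h4, smul_smul, ← add_smul]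
    have h5 : (r ^ m)⁻¹ * (m * r⁻¹) + -(m * r ^ (m - 1)) / (r ^ m) ^ 2 = 0 := by
      -- For `m = 0` the exponent `m - 1` is truncated, but its coefficient vanishes.
      rcases m with _ | m
      · simp
      · simp only [Nat.add_sub_cancel]
        field_simp
        ring
    simp only [Pi.inv_apply]
    rw [h5, zero_smul]
  rcases le_or_gt R 0 with hR | hR
  · exact ⟨0, fun r hr => absurd (hr.1.trans hr.2) hR.not_gt⟩
  refine ⟨((R / 2) ^ m)⁻¹ • ∫ y, quadBump a (R / 2) y ^ 2 • f y ∂μ, fun r hr => ?_⟩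
  have h2 : R / 2 ∈ Ioo 0 R := ⟨by linarith, by linarith⟩
  have h3 := isOpen_Ioo.is_const_of_deriv_eq_zero isPreconnected_Ioo
    (fun s hs => (hderiv s hs).differentiableAt.differentiableWithinAt)
    (fun s hs => (hderiv s hs).deriv) h2 hr
  rw [h3, smul_smul, mul_inv_cancel₀ (pow_ne_zero m hr.1.ne'), one_smul]

/-- The mean value property with weight `(r² - |y - a|²)₊²` for weakly harmonic functions, at a
point of continuity. -/
theorem integral_quadBump_sq_smul_eq [μ.IsAddHaarMeasure]
    (hf : IntegrableOn f (Metric.closedBall a R) μ) {m : ℕ} (hm : m = Module.finrank ℝ G + 4)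
    (h : ∀ r ∈ Ioo 0 R,
      ∫ y, (4 * r ^ 2 * quadBump a r y - m * quadBump a r y ^ 2) • f y ∂μ = 0)
    (h1 : ∀ r ∈ Ioo 0 R,
      ∫ y, (4 * r ^ 2 * quadBump a r y - m * quadBump a r y ^ 2) • (1 : ℂ) ∂μ = 0)
    (hcont : ContinuousAt f a) {r : ℝ} (hr : r ∈ Ioo 0 R) :
    ∫ y, quadBump a r y ^ 2 • f y ∂μ = (∫ y, quadBump a r y ^ 2 ∂μ) • f a := by
  have hone : IntegrableOn (fun _ : G => (1 : ℂ)) (Metric.closedBall a R) μ :=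
    integrableOn_const measure_closedBall_lt_top.ne
  obtain ⟨c, hc⟩ := exists_integral_quadBump_sq_eq hf h
  -- Applying the same homogeneity to the constant 1 supplies the normalisation without computing
  -- the integral of the kernel.
  obtain ⟨c₁, hc₁⟩ := exists_integral_quadBump_sq_eq hone h1
  have hreal (s : ℝ) : ∫ y, quadBump a s y ^ 2 • (1 : ℂ) ∂μ =
      ((∫ y, quadBump a s y ^ 2 ∂μ : ℝ) : ℂ) := by
    rw [← integral_complex_ofReal]
    simp
  set V : ℝ := μ.real (Metric.ball 0 1) with hV
  -- The squared bump is at most s⁴ and the ball has volume s^dim · `V`. As `m` is the dimension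
  -- plus 4, the powers of `s` cancel and only the oscillation of `f` near `a` remains.
  have hbound : ∀ ε > 0, ‖c - c₁ * f a‖ ≤ ε * V := by
    intro ε hε
    obtain ⟨δ, hδ, hfδ⟩ := Metric.continuousAt_iff.1 hcont ε hε
    obtain ⟨s, hs0, hs⟩ := exists_between (lt_min hδ (hr.1.trans hr.2))
    have hsR : s ∈ Ioo 0 R := ⟨hs0, hs.trans_le (min_le_right _ _)⟩
    have hsub : IntegrableOn f (Metric.closedBall a s) μ :=
      hf.mono_set (Metric.closedBall_subset_closedBall hsR.2.le)
    have hsub1 : IntegrableOn (fun _ : G => (1 : ℂ)) (Metric.closedBall a s) μ :=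
      hone.mono_set (Metric.closedBall_subset_closedBall hsR.2.le)
    have hi2 := integrable_quadBump_pow_smul hsub hs0.le two_ne_zero
    have hi3 := (integrable_quadBump_pow_smul hsub1 hs0.le two_ne_zero).mul_const (f a)
    have e1 : (s ^ m) • (c - c₁ * f a) = ∫ y in Metric.closedBall a s,
        (quadBump a s y ^ 2 • f y - quadBump a s y ^ 2 • (1 : ℂ) * f a) ∂μ := by
      rw [setIntegral_eq_integral_of_forall_compl_eq_zero
        (fun y hy => by simp [quadBump_eq_zero hs0.le hy]), integral_sub hi2 hi3,
        integral_mul_const, hc s hsR, hc₁ s hsR, smul_sub, smul_mul_assoc]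
    have e2 : ‖(s ^ m) • (c - c₁ * f a)‖ ≤ (s ^ 4 * ε) * μ.real (Metric.closedBall a s) := by
      rw [e1]
      refine norm_setIntegral_le_of_norm_le_const measure_closedBall_lt_top fun y hy => ?_
      have e3 : quadBump a s y ^ 2 • f y - quadBump a s y ^ 2 • (1 : ℂ) * f a =
          quadBump a s y ^ 2 • (f y - f a) := by
        rw [smul_sub, smul_mul_assoc, one_mul]
      have e4 : quadBump a s y ^ 2 ≤ s ^ 4 := by
        calc quadBump a s y ^ 2 ≤ (s ^ 2) ^ 2 :=
              pow_le_pow_left₀ quadBump_nonneg quadBump_le 2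
          _ = s ^ 4 := by ring
      have e5 : ‖f y - f a‖ ≤ ε := by
        rw [← dist_eq_norm]
        exact (hfδ ((Metric.mem_closedBall.1 hy).trans_lt
          (hs.trans_le (min_le_left _ _)))).le
      rw [e3, norm_smul, Real.norm_of_nonneg (sq_nonneg _)]
      gcongr
    rw [Measure.real, Measure.addHaar_closedBall _ _ hs0.le, ENNReal.toReal_mul,
      ENNReal.toReal_ofReal (by positivity), norm_smul, Real.norm_of_nonneg (by positivity), hm,
      pow_add] at e2
    have hpos : 0 < s ^ Module.finrank ℝ G * s ^ 4 := by positivity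
    refine le_of_mul_le_mul_left (e2.trans_eq ?_) hpos
    rw [hV, Measure.real]
    ring
  have hzero : c = c₁ * f a := by
    have hlim : Tendsto (fun ε : ℝ => ε * V) (𝓝[>] 0) (𝓝 0) := by
      have : Tendsto (fun ε : ℝ => ε * V) (𝓝 0) (𝓝 (0 * V)) :=
        (continuous_mul_const V).tendsto 0
      rw [zero_mul] at this
      exact this.mono_left nhdsWithin_le_nhds
    have := ge_of_tendsto hlim (eventually_nhdsWithin_of_forall hbound)
    exact sub_eq_zero.1 (norm_le_zero_iff.1 this)
  rw [hc r hr, hzero, ← smul_mul_assoc, ← hc₁ r hr, hreal, Complex.real_smul]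

theorem integral_quadBump_sq_pos [μ.IsAddHaarMeasure] (a : G) {r : ℝ} (hr : 0 < r) :
    0 < ∫ y, quadBump a r y ^ 2 ∂μ := by
  have hq : Continuous (quadBump a r) := continuous_quadBump
  refine (hq.pow 2).integral_pos_of_hasCompactSupport_nonneg_nonzero ?_ (fun y => sq_nonneg _)
    (x := a) ?_
  · refine HasCompactSupport.intro (isCompact_closedBall a r) fun y hy => ?_
    simp [quadBump_eq_zero hr.le hy]
  · simp [quadBump, hr.ne']

end MeanValue

/-! ### Regularity of the weighted mean -/

/-- Smoothing with the kernel `(r² - |y - a|²)₊²` yields `C¹` functions. -/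
theorem contDiff_integral_quadBump_sq {G : Type*} [NormedAddCommGroup G] [InnerProductSpace ℝ G]
    [FiniteDimensional ℝ G] [MeasurableSpace G] [BorelSpace G] {μ : Measure G} {f : G → ℂ}
    (hf : Integrable f μ) {r : ℝ} (hr : 0 ≤ r) :
    ContDiff ℝ 1 fun a => ∫ y, quadBump a r y ^ 2 • f y ∂μ := by
  have h1 : ContDiff ℝ 1 fun u : ℝ => max 0 u ^ 2 := by
    have hd (u : ℝ) : HasDerivAt (fun u : ℝ => max 0 u ^ 2) (2 * max 0 u) u := by
      simpa using hasDerivAt_max_zero_pow 0 u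
    rw [contDiff_one_iff_deriv]
    refine ⟨fun u => (hd u).differentiableAt, ?_⟩
    rw [show deriv (fun u : ℝ => max 0 u ^ 2) = fun u => 2 * max 0 u from
      funext fun u => (hd u).deriv]
    fun_prop
  have h2 : ContDiff ℝ 1 fun y : G => quadBump 0 r y ^ 2 := by
    simp only [quadBump, sub_zero]
    exact h1.comp (contDiff_const.sub (contDiff_norm_sq ℝ))
  have h3 : HasCompactSupport fun y : G => quadBump 0 r y ^ 2 :=
    HasCompactSupport.intro (isCompact_closedBall 0 r) fun y hy => by
      simp [quadBump_eq_zero hr hy]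
  have h4 := h3.contDiff_convolution_right (n := 1)
    (ContinuousLinearMap.lsmul ℝ ℝ : ℝ →L[ℝ] ℂ →L[ℝ] ℂ).flip hf.locallyIntegrable h2
  convert! h4 using 1
  ext a
  simp [convolution_def, quadBump, norm_sub_rev]

/-- A `C¹` function that is holomorphic on a dense subset of an open set is holomorphic there. -/
theorem differentiableOn_complex_of_dense {G : Type*} [NormedAddCommGroup G] [NormedSpace ℝ G]
    [NormedSpace ℂ G] [IsScalarTower ℝ ℂ G] {g : G → ℂ} (hg : ContDiff ℝ 1 g) {U D : Set G}
    (hU : IsOpen U) (hD : Dense D) (h : ∀ x ∈ U ∩ D, DifferentiableAt ℂ g x) :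
    DifferentiableOn ℂ g U := by
  -- Restriction of scalars is an isometry from a complete space, so the complex linear maps form a
  -- closed set.
  have hcl : IsClosed (range (ContinuousLinearMap.restrictScalars ℝ :
      (G →L[ℂ] ℂ) → (G →L[ℝ] ℂ))) :=
    (ContinuousLinearMap.restrictScalarsIsometry ℂ G ℂ ℝ ℝ).isometry.isClosedEmbedding.isClosed_range
  have hcont : Continuous (fderiv ℝ g) := hg.continuous_fderiv one_ne_zero
  have hsub : U ∩ D ⊆ fderiv ℝ g ⁻¹' range (ContinuousLinearMap.restrictScalars ℝ :
      (G →L[ℂ] ℂ) → (G →L[ℝ] ℂ)) := fun x hx =>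
    ⟨fderiv ℂ g x, ((h x hx).hasFDerivAt.restrictScalars ℝ).fderiv.symm⟩
  intro x hx
  have hx' := closure_minimal hsub (hcl.preimage hcont)
    (hD.open_subset_closure_inter hU hx)
  have hd : DifferentiableAt ℝ g x := hg.differentiable one_ne_zero x
  exact ((differentiableAt_iff_restrictScalars ℝ hd).2 hx').differentiableWithinAt

/-! ### Local extension, gluing and uniqueness -/

/-- Local form of the removability theorem. -/
theorem exists_differentiableOn_ball_eqOn {n : ℕ} (hn : 1 ≤ n)
    {Ω E : Set (EuclideanSpace ℂ (Fin n))} (hΩ : IsOpen Ω) (hU : IsOpen (Ω \ E))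
    (hE : Measure.hausdorffMeasure ((2 * n - 1 : ℕ) : ℝ) E = 0) (hD : Dense Eᶜ)
    {f : EuclideanSpace ℂ (Fin n) → ℂ} (hf : DifferentiableOn ℂ f (Ω \ E))
    (hf_int : LocallyIntegrableOn f Ω)
    (hf_int2 : ∀ j, LocallyIntegrableOn (purePartial2 j f) Ω)
    {a : EuclideanSpace ℂ (Fin n)} (ha : a ∈ Ω) :
    ∃ r > 0, ∃ g : EuclideanSpace ℂ (Fin n) → ℂ, Metric.ball a r ⊆ Ω ∧
      DifferentiableOn ℂ g (Metric.ball a r) ∧ EqOn g f (Metric.ball a r \ E) := by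
  obtain ⟨R, hR, hRΩ⟩ := Metric.nhds_basis_closedBall.mem_iff.1 (hΩ.mem_nhds ha)
  -- A centre within `r` of `a` needs a ball of radius larger than `r` inside `closedBall a R`,
  -- since the mean value property holds for radii strictly below the outer one; the outer radius `r
  -- + r` serves.
  obtain ⟨r, hr, hrR⟩ : ∃ r > 0, r + (r + r) ≤ R := ⟨R / 3, by positivity, by linarith⟩
  have hball : Metric.ball a r ⊆ Ω :=
    (Metric.ball_subset_closedBall.trans (Metric.closedBall_subset_closedBall (by linarith))).trans
      hRΩ
  set f₀ := (Metric.closedBall a R).indicator f with hf₀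
  have hfR : IntegrableOn f (Metric.closedBall a R) :=
    hf_int.integrableOn_compact_subset hRΩ (isCompact_closedBall a R)
  have hf₀_int : Integrable f₀ := (integrable_indicator_iff measurableSet_closedBall).2 hfR
  set κ : ℝ := ∫ y : EuclideanSpace ℂ (Fin n), quadBump 0 r y ^ 2 with hκ
  have hκ0 : κ ≠ 0 := (integral_quadBump_sq_pos 0 hr).ne'
  set g : EuclideanSpace ℂ (Fin n) → ℂ :=
    fun b => κ⁻¹ • ∫ y, quadBump b r y ^ 2 • f₀ y with hg
  have hgC : ContDiff ℝ 1 g := (contDiff_integral_quadBump_sq hf₀_int hr.le).const_smul κ⁻¹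
  have heq : EqOn g f (Metric.ball a r \ E) := by
    intro b hb
    have hbR : Metric.closedBall b (r + r) ⊆ Metric.closedBall a R :=
      Metric.closedBall_subset_closedBall' (by linarith [Metric.mem_ball.1 hb.1])
    have hbr : Metric.closedBall b r ⊆ Metric.closedBall a R :=
      (Metric.closedBall_subset_closedBall (by linarith)).trans hbR
    have hmv : ∫ y, quadBump b r y ^ 2 • f y = (∫ y, quadBump b r y ^ 2) • f b := by
      refine integral_quadBump_sq_smul_eq (R := r + r) (m := 2 * n + 4) (hfR.mono_set hbR)
        (by rw [finrank_real_euclideanSpace_complex hn]; omega) (fun s hs => ?_) (fun s hs => ?_)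
        (hf.differentiableAt (hU.mem_nhds ⟨hball hb.1, hb.2⟩)).continuousAt ⟨hr, by linarith⟩
      · have hs' := (Metric.closedBall_subset_closedBall hs.2.le).trans (hbR.trans hRΩ)
        simpa using integral_quadBump_laplacian_smul_eq_zero hn hU hE hf hf_int hf_int2 hs.1.le hs'
      · have h1 : ∀ j : Fin n ⊕ Fin n,
            purePartial2 j (fun _ : EuclideanSpace ℂ (Fin n) => (1 : ℂ)) = fun _ => 0 := by
          intro j
          ext w
          simp [purePartial2, lineDeriv]
        -- The constant 1 is itself a case of weak harmonicity, with empty exceptional set.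
        simpa using integral_quadBump_laplacian_smul_eq_zero hn (Ω := univ) (E := ∅)
          (f := fun _ => (1 : ℂ)) (by simp) (by simp) (by fun_prop)
          ((locallyIntegrable_const _).locallyIntegrableOn _)
          (fun j => by rw [h1]; exact (locallyIntegrable_const _).locallyIntegrableOn _)
          hs.1.le (subset_univ (Metric.closedBall b s))
    have hff₀ : ∀ y, quadBump b r y ^ 2 • f₀ y = quadBump b r y ^ 2 • f y := by
      intro y
      by_cases hy : y ∈ Metric.closedBall b r
      · rw [hf₀, indicator_of_mem (hbr hy)]
      · simp [quadBump_eq_zero hr.le hy]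
    simp only [hg, hff₀]
    rw [hmv, integral_quadBump_sq_eq, smul_smul, inv_mul_cancel₀ hκ0, one_smul]
  refine ⟨r, hr, g, hball, ?_, heq⟩
  refine differentiableOn_complex_of_dense hgC Metric.isOpen_ball hD fun x hx => ?_
  have hV : IsOpen (Metric.ball a r \ E) := by
    have : Metric.ball a r \ E = Metric.ball a r ∩ (Ω \ E) := by
      ext y
      exact ⟨fun hy => ⟨hy.1, hball hy.1, hy.2⟩, fun hy => ⟨hy.1, hy.2.2⟩⟩
    rw [this]
    exact Metric.isOpen_ball.inter hU
  exact (hf.differentiableAt (hU.mem_nhds ⟨hball hx.1, hx.2⟩)).congr_of_eventuallyEq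
    (heq.eventuallyEq_of_mem (hV.mem_nhds hx))

theorem corollary6 (n : ℕ) (hn : 1 ≤ n)
    (Ω : Set (EuclideanSpace ℂ (Fin n))) (hΩ_open : IsOpen Ω) (hΩ_conn : IsConnected Ω)
    (E : Set (EuclideanSpace ℂ (Fin n))) (hEΩ : E ⊆ Ω)
    (hE_closed : IsClosed ((fun z : Ω => (z : EuclideanSpace ℂ (Fin n))) ⁻¹' E))
    (hE_null : Measure.hausdorffMeasure (2 * (n : ℝ) - 1) E = 0)
    (f : EuclideanSpace ℂ (Fin n) → ℂ)
    (hf_holo : DifferentiableOn ℂ f (Ω \ E))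
    (hf_int : MemL1Loc Ω E f)
    (hf_int2 : ∀ j : Fin n ⊕ Fin n, MemL1Loc Ω E (purePartial2 j f)) :
    (∃ g : EuclideanSpace ℂ (Fin n) → ℂ, IsHolomorphicExtension Ω E f g) ∧
      ∀ g₁ g₂ : EuclideanSpace ℂ (Fin n) → ℂ,
        IsHolomorphicExtension Ω E f g₁ → IsHolomorphicExtension Ω E f g₂ → EqOn g₁ g₂ Ω := by
  have hU : IsOpen (Ω \ E) := by
    have h1 := hΩ_open.isOpenMap_subtype_val _ hE_closed.isOpen_compl
    rwa [← preimage_compl, Subtype.image_preimage_coe] at h1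
  have hE : Measure.hausdorffMeasure ((2 * n - 1 : ℕ) : ℝ) E = 0 := by
    rw [Nat.cast_sub (by omega)]
    push_cast
    exact hE_null
  have hE0 : volume E = 0 :=
    measure_eq_zero_of_hausdorffMeasure volume (finrank_real_euclideanSpace_complex hn) hE
  have hE_ae : ∀ᵐ x, x ∈ Eᶜ := measure_eq_zero_iff_ae_notMem.1 hE0
  have hD : Dense Eᶜ := Measure.dense_of_ae hE_ae
  have hcl : Ω ⊆ closure (Ω \ E) := hD.open_subset_closure_inter hΩ_open
  -- As `E` is null, restricting the measure to its complement changes nothing, and the hypotheses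
  -- become ordinary local integrability.
  simp only [MemL1Loc, Measure.restrict_eq_self_of_ae_mem hE_ae] at hf_int hf_int2
  have hloc : ∀ a ∈ Ω, ∃ r > 0, ∃ g : EuclideanSpace ℂ (Fin n) → ℂ, Metric.ball a r ⊆ Ω ∧
      DifferentiableOn ℂ g (Metric.ball a r) ∧ EqOn g f (Metric.ball a r \ E) :=
    fun a ha => exists_differentiableOn_ball_eqOn hn hΩ_open hU hE hD hf_holo hf_int hf_int2 ha
  -- Extending by limits along `Ω \ E` is canonical: it agrees with every local extension, so no
  -- compatibility on overlaps has to be checked.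
  refine ⟨⟨extendFrom (Ω \ E) f, fun a ha => ?_, fun a ha => ?_⟩, fun g₁ g₂ h₁ h₂ => ?_⟩
  · obtain ⟨r, hr, g, hball, hg, hgf⟩ := hloc a ha
    have heq : EqOn (extendFrom (Ω \ E) f) g (Metric.ball a r) := by
      intro b hb
      refine extendFrom_eq (hcl (hball hb)) ?_
      have h1 : Tendsto g (𝓝[Ω \ E] b) (𝓝 (g b)) :=
        (hg.differentiableAt (Metric.isOpen_ball.mem_nhds hb)).continuousAt.mono_left
          nhdsWithin_le_nhds
      refine h1.congr' ?_
      filter_upwards [self_mem_nhdsWithin,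
        mem_nhdsWithin_of_mem_nhds (Metric.isOpen_ball.mem_nhds hb)] with y hy hy'
      exact hgf ⟨hy', hy.2⟩
    have hnhds : Metric.ball a r ∈ 𝓝 a := Metric.ball_mem_nhds a hr
    exact ((hg.differentiableAt hnhds).congr_of_eventuallyEq
      (heq.eventuallyEq_of_mem hnhds)).differentiableWithinAt
  · exact extendFrom_eq (subset_closure ha)
      ((hf_holo.continuousOn a ha).mono_left le_rfl)
  · exact (h₁.2.trans h₂.2.symm).of_subset_closure h₁.1.continuousOn h₂.1.continuousOn
      sdiff_subset hcl
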